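/- Let $D$ be a Dedekind domain with quotient field $F$, let $G=SL_2(D)$ act on $\mathbb{P}^1(F)=F\cup\{\infty\}$ by linear fractional transformations, and for $r\in D$ put $T(r)=\begin{pmatrix}1&r\\0&1\end{pmatrix}$. For an ideal $\mathfrak q$ of $D$ let $SL_2(D,\mathfrak q)=\{X\in G: X\equiv I_2 \pmod{\mathfrak q}\}$, and let $NE_2(D,\mathfrak q)$ be the normal subgroup of $G$ generated by all $T(q)$ with $q\in\mathfrak q$. Let $H$ be a subgroup of $G$. - $H$ is a congruence subgroup if $SL_2(D,\mathfrak q)\le H$ for some ideal $\mathfrak q\neq\{0\}$. - The level $l(H)$ is the largest ideal $\mathfrak q$ of $D$ with $NE_2(D,\mathfrak q)\le H$. - The $H$-cusps are the orbits of $H$ on the $G$-orbit of $\infty$. - For $g\in G$, $\mathfrak c(H,g)$ is the largest ideal $\mathfrak q$ of $D$ such that $gT(q)g^{-1}\in H$ for all $q\in\mathfrak q$. It depends only on the $H$-cusp containing $g(\infty)$ and is called the cusp amplitude of that cusp. Let $\mathcal A(H)=\{\mathfrak c(H,g): g\in G\}$. **Theorem A.** If $H$ is a congruence subgroup of $SL_2(D)$,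 then $$\mathfrak c_{\min}=\bigcap_{\mathfrak q\in\mathcal A(H)}\mathfrak q\in\mathcal A(H)\qquad\text{and}\qquad \mathfrak c_{\max}=\sum_{\mathfrak q\in\mathcal A(H)}\mathfrak q\in\mathcal A(H).$$ In particular, there is an $H$-cusp in the $SL_2(D)$-orbit of $\infty$ whose cusp amplitude equals $l(H)$. -/

import Mathlib

open scoped MatrixGroups

namespace CuspAmplitude

section Ring

variable {R : Type*} [CommRing R]

/-- The translation matrix `T(r)`, with rows `(1, r)` and `(0, 1)`. -/
def T (r : R) : SL(2, R) := ⟨!![1, r; 0, 1], by simp [Matrix.det_fin_two]⟩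

/-- The matrix `S(r)`, with rows `(1, 0)` and `(r, 1)`. -/
def S (r : R) : SL(2, R) := ⟨!![1, 0; r, 1], by simp [Matrix.det_fin_two]⟩

theorem coe_T (r : R) : (T r : Matrix (Fin 2) (Fin 2) R) = !![1, r; 0, 1] := rfl

theorem T_add (a b : R) : T (a + b) = T a * T b := by
  ext i j
  rw [Matrix.SpecialLinearGroup.coe_mul, coe_T, coe_T, coe_T]
  fin_cases i <;> fin_cases j <;> simp [add_comm]

/-- The elementary group `E₂(R)`. -/
def elementary (R : Type*) [CommRing R] : Subgroup SL(2, R) :=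
  Subgroup.closure (Set.range (T : R → SL(2, R)) ∪ Set.range (S : R → SL(2, R)))

/-- `E₂(R, 𝔮)`: the normal subgroup of `E₂(R)` generated by the `T(q)`, `q ∈ 𝔮`. -/
def relElementary (q : Ideal R) : Subgroup SL(2, R) :=
  Subgroup.closure {x | ∃ e ∈ elementary R, ∃ a ∈ q, x = e * T a * e⁻¹}

/-- `NE₂(R, 𝔮)`: the normal subgroup of `SL₂(R)` generated by `E₂(R, 𝔮)`. -/
def normalElementary (q : Ideal R) : Subgroup SL(2, R) :=
  Subgroup.normalClosure (relElementary q : Set SL(2, R))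

/-- `SL₂(R, 𝔮)`: the matrices in `SL₂(R)` congruent to the identity modulo `𝔮`. -/
def principalCongruence (q : Ideal R) : Subgroup SL(2, R) :=
  (Matrix.SpecialLinearGroup.map (n := Fin 2) (Ideal.Quotient.mk q)).ker

/-- `H` contains `SL₂(R, 𝔮)` for some non-zero ideal `𝔮`. -/
def IsCongruenceSubgroup (H : Subgroup SL(2, R)) : Prop :=
  ∃ q : Ideal R, q ≠ ⊥ ∧ principalCongruence q ≤ H

/-- The level `l(H)`: the largest ideal `𝔮` with `NE₂(R, 𝔮) ≤ H`
(see `isGreatest_level`). -/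
def level (H : Subgroup SL(2, R)) : Ideal R :=
  sSup {q | normalElementary q ≤ H}

/-- The cusp amplitude `𝔠(H, g)`: the largest ideal `𝔮` with `g T(q) g⁻¹ ∈ H` for all
`q ∈ 𝔮` (see `isGreatest_amplitude`). -/
def amplitude (H : Subgroup SL(2, R)) (g : SL(2, R)) : Ideal R :=
  sSup {q | ∀ a ∈ q, g * T a * g⁻¹ ∈ H}

/-- The set `𝒜(H)` of all cusp amplitudes of `H`. -/
def amplitudes (H : Subgroup SL(2, R)) : Set (Ideal R) :=
  Set.range (amplitude H)

theorem isGreatest_amplitude (H : Subgroup SL(2, R)) (g : SL(2, R)) :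
    IsGreatest {q : Ideal R | ∀ a ∈ q, g * T a * g⁻¹ ∈ H} (amplitude H g) := by
  refine ⟨?_, fun q hq => le_sSup hq⟩
  intro a ha
  rw [amplitude, sSup_eq_iSup'] at ha
  refine Submodule.iSup_induction _ (motive := fun a => g * T a * g⁻¹ ∈ H) ha
    (fun q a ha => q.2 a ha) ?_ ?_
  · have : T (0 : R) = 1 := by
      ext i j
      fin_cases i <;> fin_cases j <;> simp [T]
    simp [this, H.one_mem]
  · intro x y hx hy
    have := H.mul_mem hx hy
    rw [T_add]
    simpa [mul_assoc] using this

theorem normalElementary_le_iff (H : Subgroup SL(2, R)) (q : Ideal R) :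
    normalElementary q ≤ H ↔ ∀ g : SL(2, R), ∀ a ∈ q, g * T a * g⁻¹ ∈ H := by
  constructor
  · intro h g a ha
    refine h (Subgroup.normalClosure_normal.conj_mem _ (Subgroup.subset_normalClosure ?_) g)
    exact Subgroup.subset_closure ⟨1, Subgroup.one_mem _, a, ha, by simp⟩
  · intro h
    have h' : normalElementary q ≤ H.normalCore := by
      refine Subgroup.normalClosure_le_normal ?_
      change relElementary q ≤ H.normalCore
      refine (Subgroup.closure_le _).2 ?_
      rintro x ⟨e, -, a, ha, rfl⟩ b
      have := h (b * e) a ha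
      simpa [mul_assoc] using this
    exact h'.trans (Subgroup.normalCore_le H)

theorem isGreatest_level (H : Subgroup SL(2, R)) :
    IsGreatest {q : Ideal R | normalElementary q ≤ H} (level H) := by
  refine ⟨?_, fun q hq => le_sSup hq⟩
  refine (normalElementary_le_iff H _).2 fun g a ha => ?_
  have hle : level H ≤ amplitude H g :=
    sSup_le fun q hq => le_sSup ((normalElementary_le_iff H q).1 hq g)
  exact (isGreatest_amplitude H g).1 a (hle ha)

end Ring

section Cusps

open OnePoint

variable {D : Type*} [CommRing D] (F : Type*) [Field F] [DecidableEq F] [Algebra D F]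

/-- The point `g(∞)` of `ℙ¹(F) = F ∪ {∞}`, for `g ∈ SL₂(D)` acting by linear fractional
transformations. -/
def point (g : SL(2, D)) : OnePoint F :=
  Matrix.SpecialLinearGroup.mapGL F g • (∞ : OnePoint F)

/-- The orbit of `g(∞)` under `H`. -/
def cuspOf (H : Subgroup SL(2, D)) (g : SL(2, D)) : Set (OnePoint F) :=
  MulAction.orbit (H.map (Matrix.SpecialLinearGroup.mapGL F)) (point F g)

/-- The `H`-cusps: the `H`-orbits in the `SL₂(D)`-orbit of `∞`. -/
def Cusp (H : Subgroup SL(2, D)) : Type _ :=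
  {C : Set (OnePoint F) // ∃ g : SL(2, D), C = cuspOf F H g}

variable {F}

/-- The cusp amplitude of an `H`-cusp: it is `𝔠(H, g)` for any `g ∈ SL₂(D)` such that the cusp
contains `g(∞)` (see `Cusp.amplitude_eq`). -/
noncomputable def Cusp.amplitude {H : Subgroup SL(2, D)} (C : Cusp F H) : Ideal D :=
  CuspAmplitude.amplitude H C.2.choose

theorem amplitude_le_of_eq (H : Subgroup SL(2, D)) (g₁ g₂ h s : SL(2, D)) (hh : h ∈ H)
    (hs : s 1 0 = 0) (hg : g₁ = h * g₂ * s) : amplitude H g₂ ≤ amplitude H g₁ := by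
  refine (isGreatest_amplitude H g₁).2 fun a ha => ?_
  have hdet : s 0 0 * s 1 1 = 1 := by
    have := s.det_coe
    rw [Matrix.det_fin_two, hs] at this
    simpa using this
  have key : s * T a * s⁻¹ = T (s 0 0 ^ 2 * a) := by
    rw [mul_inv_eq_iff_eq_mul]
    ext i j
    rw [Matrix.SpecialLinearGroup.coe_mul, Matrix.SpecialLinearGroup.coe_mul, coe_T, coe_T]
    fin_cases i <;> fin_cases j <;>
      simp [Matrix.mul_apply, Fin.sum_univ_two, hs]
    linear_combination (-(s 0 0) * a) * hdet
  have h2 := (isGreatest_amplitude H g₂).1 _ (Ideal.mul_mem_left _ (s 0 0 ^ 2) ha)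
  rw [← key] at h2
  have := H.mul_mem (H.mul_mem hh h2) (H.inv_mem hh)
  rw [hg]
  simpa [mul_assoc] using this

theorem amplitude_eq_of_mem_cuspOf [FaithfulSMul D F] (H : Subgroup SL(2, D))
    (g₁ g₂ : SL(2, D)) (h : point F g₁ ∈ cuspOf F H g₂) : amplitude H g₁ = amplitude H g₂ := by
  obtain ⟨⟨_, h, hh, rfl⟩, he⟩ := h
  have he' : Matrix.SpecialLinearGroup.mapGL F h • point F g₂ = point F g₁ := he
  have aux : Matrix.SpecialLinearGroup.mapGL F (g₂⁻¹ * h⁻¹ * g₁) • (∞ : OnePoint F) = ∞ := by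
    rw [map_mul, map_mul, mul_smul, mul_smul]
    change _ • _ • point F g₁ = _
    rw [← he', map_inv, map_inv, inv_smul_smul]
    simp [point]
  have hinj := FaithfulSMul.algebraMap_injective D F
  have hs : (g₂⁻¹ * h⁻¹ * g₁) 1 0 = 0 := by
    rw [OnePoint.smul_infty_eq_self_iff] at aux
    rw [← map_eq_zero_iff _ hinj]
    exact aux
  have hs' : ((g₂⁻¹ * h⁻¹ * g₁)⁻¹) 1 0 = 0 := by
    rw [Matrix.SpecialLinearGroup.SL2_inv_expl]
    simpa using hs
  refine le_antisymm ?_ ?_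
  · exact amplitude_le_of_eq H g₂ g₁ h⁻¹ _ (H.inv_mem hh) hs' (by group)
  · exact amplitude_le_of_eq H g₁ g₂ h _ hh hs (by group)

theorem Cusp.amplitude_eq [FaithfulSMul D F] {H : Subgroup SL(2, D)} (C : Cusp F H)
    (g : SL(2, D)) (hg : point F g ∈ C.1) : C.amplitude = CuspAmplitude.amplitude H g := by
  refine (amplitude_eq_of_mem_cuspOf (F := F) H _ _ ?_).symm
  rw [← C.2.choose_spec]
  exact hg

theorem range_cusp_amplitude [FaithfulSMul D F] (H : Subgroup SL(2, D)) :
    Set.range (Cusp.amplitude : Cusp F H → Ideal D) = amplitudes H := by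
  refine Set.Subset.antisymm ?_ ?_
  · rintro _ ⟨C, rfl⟩
    exact ⟨_, rfl⟩
  · rintro _ ⟨g, rfl⟩
    exact ⟨⟨cuspOf F H g, g, rfl⟩, Cusp.amplitude_eq _ g (MulAction.mem_orbit_self _)⟩

end Cusps

end CuspAmplitude

namespace CuspAmplitude

/-! ### Amplitudes modulo pairwise coprime ideals. -/

section CommRing

variable {R : Type*} [CommRing R]

/-! Let `principalCongruence q ≤ H` and factor `q` into prime powers `p ^ e`. Every amplitude
contains `q`, so it is determined by its components `amplitude H g ⊔ p ^ e`
(`le_iff_forall_sup_le_sup`), and the component at `p` depends only on `g` modulo `p ^ e`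
(`amplitude_sup_le_of_congr`). The ideals containing `p ^ e` form a finite chain, so each component
attains a least and a greatest value. Since `SL₂(D) → SL₂(D/q)` is surjective, matrices realising
the extreme values at the various `p` glue to a single one
(`exists_forall_inv_mul_mem_principalCongruence`), whose amplitude is extreme at all `p` at once.
The level is the intersection of the amplitudes, so the minimal amplitude is the level. -/

theorem mem_principalCongruence_iff {q : Ideal R} {g : SL(2, R)} :
    g ∈ principalCongruence q ↔
      ∀ i j, Ideal.Quotient.mk q (g i j) = Ideal.Quotient.mk q ((1 : SL(2, R)) i j) := by
  rw [principalCongruence, MonoidHom.mem_ker,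
    ← map_one (Matrix.SpecialLinearGroup.map (n := Fin 2) (Ideal.Quotient.mk q)),
    Matrix.SpecialLinearGroup.ext_iff]
  rfl

theorem principalCongruence_iInf {ι : Type*} (I : ι → Ideal R) :
    principalCongruence (⨅ i, I i) = ⨅ i, principalCongruence (I i) := by
  ext g
  simp only [Subgroup.mem_iInf, mem_principalCongruence_iff, Ideal.Quotient.eq, Ideal.mem_iInf]
  exact ⟨fun h k i j => h i j k, fun h i j k => h k i j⟩

theorem T_mem_principalCongruence {q : Ideal R} {a : R} (ha : a ∈ q) :
    T a ∈ principalCongruence q := by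
  rw [mem_principalCongruence_iff]
  intro i j
  rw [Ideal.Quotient.eq]
  fin_cases i <;> fin_cases j <;> simp [T, ha]

theorem le_amplitude_of_principalCongruence_le {H : Subgroup SL(2, R)} {q : Ideal R}
    (h : principalCongruence q ≤ H) (g : SL(2, R)) : q ≤ amplitude H g := by
  refine (isGreatest_amplitude H g).2 fun a ha => h ?_
  have : (principalCongruence q).Normal := MonoidHom.normal_ker _
  exact this.conj_mem _ (T_mem_principalCongruence ha) g

theorem level_eq_sInf_amplitudes (H : Subgroup SL(2, R)) : level H = sInf (amplitudes H) := by
  refine le_antisymm (le_sInf ?_) ((isGreatest_level H).2 ?_)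
  · rintro _ ⟨g, rfl⟩
    exact (isGreatest_amplitude H g).2
      ((normalElementary_le_iff H _).1 (isGreatest_level H).1 g)
  · refine (normalElementary_le_iff H _).2 fun g a ha => (isGreatest_amplitude H g).1 a ?_
    exact (sInf_le (Set.mem_range_self g) : sInf (amplitudes H) ≤ amplitude H g) ha

/-- If `g ≡ g'` modulo `I i`, then conjugation by `g` and by `g'` agree modulo `⨅ j, I j` on the
translations `T a` with `a ∈ I j` for all `j ≠ i`. -/
theorem conj_T_mem_of_congr {ι : Type*} {I : ι → Ideal R} {H : Subgroup SL(2, R)}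
    (hH : principalCongruence (⨅ i, I i) ≤ H) {i : ι} {g g' : SL(2, R)}
    (hg : g⁻¹ * g' ∈ principalCongruence (I i)) {a : R} (ha : ∀ j, j ≠ i → a ∈ I j)
    (h : g * T a * g⁻¹ ∈ H) : g' * T a * g'⁻¹ ∈ H := by
  have key : (g * T a * g⁻¹)⁻¹ * (g' * T a * g'⁻¹) ∈ H := by
    refine hH ?_
    rw [principalCongruence_iInf, Subgroup.mem_iInf]
    intro j
    rw [principalCongruence, MonoidHom.mem_ker, map_mul, map_inv, inv_mul_eq_one]
    rw [principalCongruence, MonoidHom.mem_ker, map_mul, map_inv, inv_mul_eq_one] at hg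
    -- Modulo `I i` the conjugators coincide; modulo any other `I j` the translation `T a` is
    -- trivial.
    by_cases hj : j = i
    · subst hj
      simp only [map_mul, map_inv, hg]
    · have := MonoidHom.mem_ker.1 (T_mem_principalCongruence (ha j hj))
      simp only [map_mul, map_inv, this, mul_one, mul_inv_cancel]
  simpa only [mul_inv_cancel_left] using H.mul_mem h key

theorem exists_idempotents_mod {ι : Type*} [Finite ι] {I : ι → Ideal R}
    (hI : Pairwise fun i j => IsCoprime (I i) (I j)) (i : ι) :
    ∃ m : R, 1 - m ∈ I i ∧ ∀ j, j ≠ i → m ∈ I j := by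
  classical
  obtain ⟨m, hm⟩ := Ideal.exists_forall_sub_mem_ideal hI (Pi.single i 1)
  refine ⟨m, ?_, fun j hj => ?_⟩
  · simpa using neg_mem (hm i)
  · simpa [hj] using hm j

/-- Split `x` as `(1 - ∑ mᵢ) x + ∑ mᵢ x` with the `mᵢ` idempotent modulo `⨅ i, I i`. The first term
lies in `⨅ i, I i`, and multiplication by `mᵢ` sends `I i` into `⨅ i, I i`. -/
theorem le_iff_forall_sup_le_sup {ι : Type*} [Finite ι] {I : ι → Ideal R}
    (hI : Pairwise fun i j => IsCoprime (I i) (I j)) {J K : Ideal R} (hK : ⨅ i, I i ≤ K) :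
    J ≤ K ↔ ∀ i, J ⊔ I i ≤ K ⊔ I i := by
  refine ⟨fun h i => sup_le_sup_right h _, fun h x hx => ?_⟩
  classical
  cases nonempty_fintype ι
  choose m hm hm' using exists_idempotents_mod hI
  have h1 : (1 - ∑ i, m i) * x ∈ K := by
    refine K.mul_mem_right _ (hK ((Ideal.mem_iInf).2 fun i => ?_))
    rw [← Finset.add_sum_erase _ _ (Finset.mem_univ i), ← sub_sub]
    exact sub_mem (hm i) (Ideal.sum_mem _ fun j hj => hm' j i (Finset.ne_of_mem_erase hj).symm)
  have h2 : (∑ i, m i) * x ∈ K := by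
    rw [Finset.sum_mul]
    refine Ideal.sum_mem _ fun i _ => ?_
    obtain ⟨k, hk, y, hy, rfl⟩ := Submodule.mem_sup.1 (h i (Ideal.mem_sup_left hx))
    rw [mul_add]
    refine K.add_mem (K.mul_mem_left _ hk) (hK ((Ideal.mem_iInf).2 fun j => ?_))
    by_cases hj : j = i
    · subst hj
      exact (I j).mul_mem_left _ hy
    · exact (I j).mul_mem_right _ (hm' i j hj)
  simpa [sub_mul] using K.add_mem h1 h2

/-- Replacing `x` by `m * x` does not change it modulo `I i` but moves it into all the other `I j`,
where `conj_T_mem_of_congr` applies. -/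
theorem amplitude_sup_le_of_congr {ι : Type*} [Finite ι] {I : ι → Ideal R}
    (hI : Pairwise fun i j => IsCoprime (I i) (I j)) {H : Subgroup SL(2, R)}
    (hH : principalCongruence (⨅ i, I i) ≤ H) {i : ι} {g g' : SL(2, R)}
    (hg : g⁻¹ * g' ∈ principalCongruence (I i)) :
    amplitude H g ⊔ I i ≤ amplitude H g' ⊔ I i := by
  obtain ⟨m, hm, hm'⟩ := exists_idempotents_mod hI i
  refine sup_le (fun x hx => ?_) le_sup_right
  have h1 : amplitude H g ⊓ ⨅ j : {j // j ≠ i}, I j ≤ amplitude H g' := by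
    refine (isGreatest_amplitude H g').2 fun a ha => ?_
    refine conj_T_mem_of_congr hH hg (fun j hj => ?_) ((isGreatest_amplitude H g).1 a ha.1)
    exact (Ideal.mem_iInf).1 ha.2 ⟨j, hj⟩
  have h2 : m * x ∈ amplitude H g' :=
    h1 ⟨Ideal.mul_mem_left _ _ hx,
      (Ideal.mem_iInf).2 fun j => (I j).mul_mem_right _ (hm' j j.2)⟩
  have := Submodule.add_mem_sup h2 ((I i).mul_mem_right x hm)
  convert this using 1
  ring

end CommRing

/-! ### Lifting matrices and gluing over a Dedekind domain. -/

section Dedekind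

variable {D : Type*} [CommRing D] [IsDedekindDomain D]

/-- Only finitely many primes contain `c`. At those containing `q`, `h` already excludes `d`; at the
others, `d'` is made congruent to 1. -/
theorem exists_isCoprime_add_mem {q : Ideal D} {c d : D} (hc : c ≠ 0)
    (h : q ⊔ Ideal.span {c} ⊔ Ideal.span {d} = ⊤) : ∃ d', d' - d ∈ q ∧ IsCoprime c d' := by
  classical
  have hfin := Ideal.finite_factors (I := Ideal.span {c}) (by simpa using hc)
  let s := hfin.toFinset.filter fun v => ¬ q ≤ v.asIdeal
  have hcop : q ⊔ ∏ v ∈ s, v.asIdeal = ⊤ :=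
    Ideal.sup_prod_eq_top fun v hv => by
      rw [sup_comm]
      exact v.isMaximal.out.2 _ (left_lt_sup.2 (Finset.mem_filter.1 hv).2)
  obtain ⟨x, hx, y, hy, hxy⟩ := Submodule.mem_sup.1 ((Ideal.eq_top_iff_one _).1 hcop)
  refine ⟨d + x * (1 - d), by simpa using q.mul_mem_right _ hx, ?_⟩
  rw [← Ideal.isCoprime_span_singleton_iff, Ideal.isCoprime_iff_sup_eq]
  by_contra hne
  obtain ⟨p, hp, hle⟩ := Ideal.exists_le_maximal _ hne
  have hcp : c ∈ p := hle (Ideal.mem_sup_left (Ideal.mem_span_singleton_self c))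
  have hdp : d + x * (1 - d) ∈ p := hle (Ideal.mem_sup_right (Ideal.mem_span_singleton_self _))
  by_cases hqp : q ≤ p
  · refine hp.ne_top (top_le_iff.1 (h ▸ sup_le (sup_le hqp ?_) ?_))
    · rwa [Ideal.span_singleton_le_iff_mem]
    · rw [Ideal.span_singleton_le_iff_mem]
      exact (Ideal.add_mem_iff_left _ (p.mul_mem_right _ (hqp hx))).1 hdp
  · let v : IsDedekindDomain.HeightOneSpectrum D :=
      ⟨p, hp.isPrime, fun h0 => hc (by simpa [h0] using hcp)⟩
    have hv : v ∈ s := by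
      refine Finset.mem_filter.2 ⟨hfin.mem_toFinset.2 ?_, hqp⟩
      exact Ideal.dvd_span_singleton.2 hcp
    have hyp : y ∈ p := Ideal.le_of_dvd (Finset.dvd_prod_of_mem _ hv) hy
    refine hp.ne_top ((Ideal.eq_top_iff_one _).2 ?_)
    have := p.add_mem hdp (p.mul_mem_right (1 - d) hyp)
    convert this using 1
    linear_combination (-1 + d) * hxy

/-- Reduction `SL₂(D) → SL₂(D/q)` is surjective. -/
theorem exists_SL2_congr {q : Ideal D} (hq : q ≠ ⊥) (A : Matrix (Fin 2) (Fin 2) D)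
    (hA : A.det - 1 ∈ q) : ∃ g : SL(2, D), ∀ i j, g i j - A i j ∈ q := by
  rw [Matrix.det_fin_two] at hA
  -- A zero lower-left entry is replaced by a nonzero element of `q`, so that only finitely many
  -- primes contain it.
  obtain ⟨c, hc, hcA⟩ : ∃ c, c ≠ 0 ∧ c - A 1 0 ∈ q := by
    by_cases h0 : A 1 0 = 0
    · obtain ⟨x, hx, hx0⟩ := Submodule.exists_mem_ne_zero_of_ne_bot hq
      exact ⟨x, hx0, by simpa [h0] using hx⟩
    · exact ⟨_, h0, by simp⟩
  have htop : q ⊔ Ideal.span {c} ⊔ Ideal.span {A 1 1} = ⊤ := by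
    rw [Ideal.eq_top_iff_one]
    have h1 : A 0 0 * A 1 1 - A 0 1 * A 1 0 - 1 - A 0 1 * (c - A 1 0) ∈
        q ⊔ Ideal.span {c} ⊔ Ideal.span {A 1 1} :=
      Ideal.mem_sup_left (Ideal.mem_sup_left (sub_mem hA (q.mul_mem_left (A 0 1) hcA)))
    have h2 : A 0 1 * c ∈ q ⊔ Ideal.span {c} ⊔ Ideal.span {A 1 1} :=
      Ideal.mul_mem_left _ _ (Ideal.mem_sup_left (Ideal.mem_sup_right
        (Ideal.mem_span_singleton_self c)))
    have h3 : A 0 0 * A 1 1 ∈ q ⊔ Ideal.span {c} ⊔ Ideal.span {A 1 1} :=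
      Ideal.mul_mem_left _ _ (Ideal.mem_sup_right (Ideal.mem_span_singleton_self _))
    convert sub_mem (sub_mem h3 h2) h1 using 1
    ring
  obtain ⟨d, hdA, v, u, huv⟩ := exists_isCoprime_add_mem hc htop
  let n := A 0 0 * d - A 0 1 * c - 1
  have hn : n ∈ q := by
    convert q.add_mem hA (sub_mem (q.mul_mem_left (A 0 0) hdA) (q.mul_mem_left (A 0 1) hcA))
      using 1
    ring
  -- As `v * c + u * d = 1`, this change of the top row lowers the determinant `1 + n` by exactly
  -- `n`.
  refine ⟨⟨!![A 0 0 - n * u, A 0 1 + n * v; c, d], ?_⟩, ?_⟩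
  · rw [Matrix.det_fin_two_of]
    linear_combination (-n) * huv
  · intro i j
    fin_cases i <;> fin_cases j
    · simpa using q.mul_mem_right u hn
    · simpa using q.mul_mem_right v hn
    · simpa using hcA
    · simpa using hdA

theorem exists_forall_inv_mul_mem_principalCongruence {ι : Type*} [Finite ι] {I : ι → Ideal D}
    (hI : Pairwise fun i j => IsCoprime (I i) (I j)) (h0 : ⨅ i, I i ≠ ⊥) (g : ι → SL(2, D)) :
    ∃ x : SL(2, D), ∀ i, (g i)⁻¹ * x ∈ principalCongruence (I i) := by
  choose A hA using fun j k => Ideal.exists_forall_sub_mem_ideal hI fun i => g i j k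
  have hdet : (Matrix.of A).det - 1 ∈ ⨅ i, I i := by
    refine (Ideal.mem_iInf).2 fun i => ?_
    rw [← (g i).det_coe, Matrix.det_fin_two, Matrix.det_fin_two, ← Ideal.Quotient.eq]
    have h (j k) := Ideal.Quotient.eq.2 (hA j k i)
    simp [h]
  obtain ⟨x, hx⟩ := exists_SL2_congr h0 _ hdet
  refine ⟨x, fun i => ?_⟩
  rw [principalCongruence, MonoidHom.mem_ker, map_mul, map_inv, inv_mul_eq_one]
  ext j k
  refine (Ideal.Quotient.eq.2 ?_).symm
  simpa using (I i).add_mem ((Ideal.mem_iInf).1 (hx j k) i) (hA j k i)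

/-- A nonzero ideal of a Dedekind domain is a finite intersection of pairwise coprime prime
powers. -/
theorem exists_iInf_prime_pow_eq {q : Ideal D} (hq : q ≠ ⊥) :
    ∃ (s : Finset (Ideal D)) (e : s → ℕ), (∀ p : s, Prime (p : Ideal D)) ∧
      (Pairwise fun i j : s => IsCoprime ((i : Ideal D) ^ e i) ((j : Ideal D) ^ e j)) ∧
      ⨅ p : s, (p : Ideal D) ^ e p = q := by
  classical
  let f := UniqueFactorizationMonoid.normalizedFactors q
  have hp (p : f.toFinset) : Prime (p : Ideal D) :=
    UniqueFactorizationMonoid.prime_of_normalized_factor _ (Multiset.mem_toFinset.1 p.2)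
  have hco : Pairwise fun i j : f.toFinset =>
      IsCoprime ((i : Ideal D) ^ f.count (i : Ideal D)) ((j : Ideal D) ^ f.count (j : Ideal D)) := by
    intro i j hij
    have hmax (p : f.toFinset) : (p : Ideal D).IsMaximal :=
      (Ideal.isPrime_of_prime (hp p)).isMaximal (hp p).ne_zero
    exact (Ideal.isCoprime_iff_sup_eq.2
      ((hmax i).coprime_of_ne (hmax j) (Subtype.coe_injective.ne hij))).pow
  refine ⟨f.toFinset, fun p => f.count (p : Ideal D), hp, hco, ?_⟩
  have h1 := Ideal.prod_eq_iInf_of_pairwise_isCoprime (s := Finset.univ) (hco.set_pairwise _)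
  simp only [Finset.mem_univ, iInf_pos] at h1
  rw [← h1, Finset.prod_coe_sort f.toFinset fun p => p ^ f.count p,
    ← Finset.prod_multiset_count]
  exact Ideal.prod_normalizedFactors_eq_self hq

/-- To contain is to divide, so both ideals are powers of `p`. -/
theorem le_total_of_prime_pow_le {p J K : Ideal D} (hp : Prime p) {n : ℕ} (hJ : p ^ n ≤ J)
    (hK : p ^ n ≤ K) : J ≤ K ∨ K ≤ J := by
  obtain ⟨i, -, hi⟩ := (dvd_prime_pow hp n).1 (Ideal.dvd_iff_le.2 hJ)
  obtain ⟨j, -, hj⟩ := (dvd_prime_pow hp n).1 (Ideal.dvd_iff_le.2 hK)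
  rw [associated_iff_eq.1 hi, associated_iff_eq.1 hj]
  exact (le_total j i).imp Ideal.pow_le_pow_right Ideal.pow_le_pow_right

theorem finite_setOf_ideal_ge {q : Ideal D} (hq : q ≠ ⊥) : {J : Ideal D | q ≤ J}.Finite := by
  have : Fintype {J : Ideal D // J ∣ q} := UniqueFactorizationMonoid.fintypeSubtypeDvd q hq
  refine Set.Finite.subset (s := {J : Ideal D | J ∣ q}) (Set.finite_coe_iff.1 ?_) fun J hJ => ?_
  · exact Finite.of_fintype {J : Ideal D // J ∣ q}
  · exact Ideal.dvd_iff_le.2 hJ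

theorem exists_isLeast_and_isGreatest_amplitudes {H : Subgroup SL(2, D)} (hH : IsCongruenceSubgroup H) :
    (∃ J, IsLeast (amplitudes H) J) ∧ ∃ J, IsGreatest (amplitudes H) J := by
  obtain ⟨q, hq, hqH⟩ := hH
  obtain ⟨s, e, hp, hco, rfl⟩ := exists_iInf_prime_pow_eq hq
  let c (i : s) (g : SL(2, D)) : Ideal D := amplitude H g ⊔ (i : Ideal D) ^ e i
  have hfin (i : s) : (Set.range (c i)).Finite := by
    refine (finite_setOf_ideal_ge (q := (i : Ideal D) ^ e i) (pow_ne_zero _ (hp i).ne_zero)).subset ?_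
    rintro _ ⟨g, rfl⟩
    exact le_sup_right (a := amplitude H g)
  have htot (i : s) (g g' : SL(2, D)) : c i g ≤ c i g' ∨ c i g' ≤ c i g :=
    le_total_of_prime_pow_le (hp i) le_sup_right le_sup_right
  have hN := le_amplitude_of_principalCongruence_le hqH
  constructor
  · have hmin (i : s) : ∃ g, ∀ g', c i g ≤ c i g' := by
      obtain ⟨_, ⟨g, rfl⟩, hg⟩ := (hfin i).exists_minimal (Set.range_nonempty _)
      -- In a chain, a minimal element is least.
      exact ⟨g, fun g' => (htot i g g').elim id fun h => hg ⟨g', rfl⟩ h⟩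
    choose g hg using hmin
    obtain ⟨x, hx⟩ := exists_forall_inv_mul_mem_principalCongruence hco hq g
    refine ⟨_, ⟨x, rfl⟩, ?_⟩
    rintro _ ⟨g', rfl⟩
    refine (le_iff_forall_sup_le_sup hco (hN g')).2 fun i => le_trans ?_ (hg i g')
    exact amplitude_sup_le_of_congr hco hqH (by simpa using inv_mem (hx i))
  · have hmax (i : s) : ∃ g, ∀ g', c i g' ≤ c i g := by
      obtain ⟨_, ⟨g, rfl⟩, hg⟩ := (hfin i).exists_maximal (Set.range_nonempty _)
      exact ⟨g, fun g' => (htot i g' g).elim id fun h => hg ⟨g', rfl⟩ h⟩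
    choose g hg using hmax
    obtain ⟨x, hx⟩ := exists_forall_inv_mul_mem_principalCongruence hco hq g
    refine ⟨_, ⟨x, rfl⟩, ?_⟩
    rintro _ ⟨g', rfl⟩
    refine (le_iff_forall_sup_le_sup hco (hN x)).2 fun i => (hg i g').trans ?_
    exact amplitude_sup_le_of_congr hco hqH (hx i)

end Dedekind

end CuspAmplitude

theorem theoremA {D : Type*} [CommRing D] [IsDedekindDomain D]
    {F : Type*} [Field F] [DecidableEq F] [Algebra D F] [IsFractionRing D F]
    (H : Subgroup SL(2, D)) (hH : CuspAmplitude.IsCongruenceSubgroup H) :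
    sInf (CuspAmplitude.amplitudes H) ∈ CuspAmplitude.amplitudes H ∧
    sSup (CuspAmplitude.amplitudes H) ∈ CuspAmplitude.amplitudes H ∧
    ∃ C : CuspAmplitude.Cusp F H, C.amplitude = CuspAmplitude.level H := by
  obtain ⟨⟨J, hJ⟩, K, hK⟩ := CuspAmplitude.exists_isLeast_and_isGreatest_amplitudes hH
  have hmin : sInf (CuspAmplitude.amplitudes H) ∈ CuspAmplitude.amplitudes H :=
    hJ.isGLB.sInf_eq ▸ hJ.1
  have hmax : sSup (CuspAmplitude.amplitudes H) ∈ CuspAmplitude.amplitudes H :=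
    hK.isLUB.sSup_eq ▸ hK.1
  refine ⟨hmin, hmax, ?_⟩
  have : FaithfulSMul D F := (faithfulSMul_iff_algebraMap_injective D F).2
    (IsFractionRing.injective D F)
  rw [CuspAmplitude.level_eq_sInf_amplitudes]
  exact (CuspAmplitude.range_cusp_amplitude (F := F) H).symm.subset hmin
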